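/- Let $(\tau_j)_{j\ge 1}$ be independent random variables, uniformly distributed on $[0,1]$, on a probability space $(\Omega,\Sigma,\mathbb P)$; let $h>0$ and $\eta\in\mathbb C\setminus\{0\}$. For $\lambda\in\mathbb C$ apply the randomized two-stage Runge–Kutta scheme with step size $h$, $$V^0=\eta,\qquad V^j_\tau=V^{j-1}+h\tau_j f(t_{j-1},V^{j-1}),\qquad V^j=V^{j-1}+h f(t_{j-1}+\tau_j h,\,V^j_\tau),\qquad t_j=jh,$$ to the test problem $z'(t)=\lambda z(t)$, $z(0)=\eta$, i.e. with $f(t,v)=\lambda v$; then $V^k=\eta\prod_{j=1}^k p_j(h\lambda)$ with $p_j(z)=\tau_j z^2+z+1$. Let $\mathcal R^{AS}$ be the region of asymptotic stability, i.e. the set of all $z=h\lambda$, $\lambda\in\mathbb C$, for which $V^k\to 0$ almost surely as $k\to\infty$, and let $\mathcal R^{Mid}=\{z\in\mathbb C: |\tfrac12 z^2+z+1|^2<1\}$ be the stability region of the deterministic midpoint scheme. Put $\mathcal I^{\diamond}=\mathcal R^{\diamond}\cap\{z\in\mathbb C:\operatorname{Im} z=0\}$ for $\diamond\in\{AS,Mid\}$.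 Then $\ln|\tau_1z^2+z+1|$ is integrable for every $z\in\mathbb C$, $\mathcal R^{AS}=\{z\in\mathbb C:\mathbb E\ln|\tau_1z^2+z+1|<0\}$, and the following hold. (i) $\mathcal R^{AS}$ is open and symmetric with respect to the real axis. (ii) $\mathcal I^{Mid}\subseteq[-2,0)\subseteq\mathcal I^{AS}\subseteq(-\sqrt{2e},0)$. (iii) There exists $r_0\in(0,\infty)$ such that $\mathcal R^{AS}\subseteq\{z\in\mathbb C:\operatorname{Re} z<0,\ |z|<r_0\}$. -/

import Mathlib

open MeasureTheory ProbabilityTheory Filter Topology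

/-- One trajectory of the randomized two-stage Runge-Kutta scheme with exact information and step
size `h` on the mesh `t_j = j h`, for `z'(t) = f(t, z(t))`, `z(0) = η`:
`V^0 = η`, and in step `k + 1`, with `u = u k` the random number of that step,
`V_τ = V^k + h u f(t_k, V^k)` and `V^{k+1} = V^k + h f(t_k + u h, V_τ)`. -/
noncomputable def rrkScheme (f : ℝ → ℂ → ℂ) (h : ℝ) (η : ℂ) (u : ℕ → ℝ) : ℕ → ℂ
  | 0 => η
  | k + 1 =>
    let t : ℝ := k * h
    let V : ℂ := rrkScheme f h η u k
    let Vτ : ℂ := V + h * u k * f t V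
    V + h * f (t + u k * h) Vτ

/-- On the test problem `z' = lam * z` one has `V^k = η ∏_j p_j(h lam)`, where
`p_j(z) = τ_j z ^ 2 + z + 1`. -/
theorem rrkScheme_linear (lam : ℂ) (h : ℝ) (η : ℂ) (u : ℕ → ℝ) (k : ℕ) :
    rrkScheme (fun _ v => lam * v) h η u k =
      η * ∏ j ∈ Finset.range k, ((u j : ℂ) * (h * lam) ^ 2 + h * lam + 1) := by
  induction k with
  | zero => simp [rrkScheme]
  | succ k ih =>
    rw [Finset.prod_range_succ, ← mul_assoc, ← ih]
    simp only [rrkScheme]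
    ring

/-- The region of asymptotic (almost sure) stability: all `z = h lam` such that the scheme with step
size `h`, applied to `z'(t) = lam z(t)`, `z(0) = η`, converges to `0` almost surely. The random
variable `τ k` is the one used in step `k + 1`. -/
def regionAS {Ω : Type*} [MeasurableSpace Ω] (P : Measure Ω) (τ : ℕ → Ω → ℝ) (h : ℝ) (η : ℂ) :
    Set ℂ :=
  {z | ∃ lam : ℂ, z = h * lam ∧
    ∀ᵐ ω ∂P, Tendsto (fun k => rrkScheme (fun _ v => lam * v) h η (fun j => τ j ω) k)
      atTop (𝓝 0)}

/-- The region of absolute stability of the deterministic midpoint scheme. -/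
def regionMid : Set ℂ := {z | ‖(1 / 2 : ℂ) * z ^ 2 + z + 1‖ ^ 2 < 1}

/-- The interval of absolute stability belonging to a region: its part on the real axis. -/
def stabInterval (R : Set ℂ) : Set ℂ := R ∩ {z | z.im = 0}

/-! For fixed `z`, `log |V^k / η|` is a random walk with i.i.d. steps `log |τ_j z ^ 2 + z + 1|`,
almost surely free of zero factors. The steps are square-integrable
(`memLp_log_norm_stabilityFactor`), so the strong law settles nonzero mean and the central limit
theorem excludes mean zero: `V^k → 0` almost surely iff `meanLogGrowth z < 0`.

The rest is analysis of this integral. It is an infimum of continuous functions of `z`, hence upper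
semicontinuous, which gives openness. For `Re z ≥ 0`, pairing `t` with `1 - t` makes it nonnegative;
for large `|z|` the factor `z ^ 2` dominates. On the real axis it has a closed form in `u log u`. -/

/-! ### Random walks drifting to `-∞` -/

/-- A centered square-integrable random walk does not drift to `-∞`: by the central limit theorem it
is positive with a probability bounded away from zero. -/
theorem not_ae_tendsto_sum_atBot_of_integral_eq_zero {Ω : Type*} [MeasurableSpace Ω] {P : Measure Ω}
    [IsProbabilityMeasure P] {X : ℕ → Ω → ℝ} (hmeas : ∀ j, Measurable (X j))
    (hindep : iIndepFun X P) (hident : ∀ j, IdentDistrib (X j) (X 0) P P)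
    (hL2 : MemLp (X 0) 2 P) (hmean : ∫ ω, X 0 ω ∂P = 0) :
    ¬ ∀ᵐ ω ∂P, Tendsto (fun n => ∑ j ∈ Finset.range n, X j ω) atTop atBot := by
  intro hlim
  by_cases hv : Var[X 0; P] = 0
  · have hzero : ∀ᵐ ω ∂P, ∀ j, X j ω = 0 := by
      refine ae_all_iff.2 fun j => ?_
      have := ae_eq_integral_of_variance_eq_zero ((hident j).memLp_iff.2 hL2)
        ((hident j).variance_eq.trans hv)
      rwa [(hident j).integral_eq, hmean] at this
    obtain ⟨ω, hω, hz⟩ := (hlim.and hzero).exists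
    simp only [hz, Finset.sum_const_zero] at hω
    obtain ⟨n, hn⟩ := (hω.eventually (eventually_lt_atBot 0)).exists
    exact lt_irrefl _ hn
  · have hv' : Var[X 0; P].toNNReal ≠ 0 := by
      rw [Ne, Real.toNNReal_eq_zero, not_le]
      exact lt_of_le_of_ne (variance_nonneg _ _) (Ne.symm hv)
    have hclt := tendstoInDistribution_inv_sqrt_mul_sum_sub
      (HasLaw.id (μ := gaussianReal 0 Var[X 0; P].toNNReal)) hL2 hindep hident
    -- Portmanteau: the Gaussian mass of `(0, ∞)` is at most `liminf P(S_n > 0)`, which is `0` under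
    -- `hlim`. A nondegenerate Gaussian charges every set of positive Lebesgue measure.
    have hopen := ProbabilityMeasure.le_liminf_measure_open_of_tendsto hclt.tendsto
      (isOpen_Ioi (a := (0 : ℝ)))
    have hset : ∀ n : ℕ, MeasurableSet {ω | 0 < (√(n : ℝ))⁻¹ *
        (∑ k ∈ Finset.range n, X k ω - n * ∫ ω, X 0 ω ∂P)} := fun n =>
      measurableSet_lt measurable_const (by fun_prop)
    have hzero : Tendsto (fun n : ℕ => P {ω | 0 < (√(n : ℝ))⁻¹ *
        (∑ k ∈ Finset.range n, X k ω - n * ∫ ω, X 0 ω ∂P)}) atTop (𝓝 (P ∅)) := by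
      refine tendsto_measure_of_ae_tendsto_indicator_of_isFiniteMeasure _ MeasurableSet.empty hset ?_
      filter_upwards [hlim] with ω hω
      filter_upwards [hω.eventually (eventually_le_atBot 0)] with n hn
      simp only [Set.mem_empty_iff_false, iff_false, not_lt, hmean, mul_zero,
        sub_zero]
      exact mul_nonpos_of_nonneg_of_nonpos (by positivity) hn
    have hmap : ∀ n : ℕ, (P.map fun ω => (√(n : ℝ))⁻¹ *
        (∑ k ∈ Finset.range n, X k ω - n * ∫ ω, X 0 ω ∂P)) (Set.Ioi 0) =
        P {ω | 0 < (√(n : ℝ))⁻¹ * (∑ k ∈ Finset.range n, X k ω - n * ∫ ω, X 0 ω ∂P)} := fun n => by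
      rw [Measure.map_apply (by fun_prop) measurableSet_Ioi]
      rfl
    simp only [ProbabilityMeasure.coe_mk, hmap, Measure.map_id] at hopen
    rw [hzero.liminf_eq, measure_empty, nonpos_iff_eq_zero] at hopen
    have := gaussianReal_absolutelyContinuous' 0 hv' hopen
    simp at this

/-- A square-integrable random walk drifts to `-∞` almost surely iff its steps have negative mean. -/
theorem ae_tendsto_sum_atBot_iff {Ω : Type*} [MeasurableSpace Ω] {P : Measure Ω}
    [IsProbabilityMeasure P] {X : ℕ → Ω → ℝ} (hmeas : ∀ j, Measurable (X j))
    (hindep : iIndepFun X P) (hident : ∀ j, IdentDistrib (X j) (X 0) P P)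
    (hL2 : MemLp (X 0) 2 P) :
    (∀ᵐ ω ∂P, Tendsto (fun n => ∑ j ∈ Finset.range n, X j ω) atTop atBot) ↔
      ∫ ω, X 0 ω ∂P < 0 := by
  have hslln := strong_law_ae_real X (hL2.integrable (by norm_num))
    (fun i j hij => hindep.indepFun hij) hident
  have hcancel : ∀ ω, (fun n : ℕ => (∑ i ∈ Finset.range n, X i ω) / n * (n : ℝ)) =ᶠ[atTop]
      fun n => ∑ i ∈ Finset.range n, X i ω := fun ω => by
    filter_upwards [eventually_ne_atTop 0] with n hn
    field_simp
  constructor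
  · intro hlim
    by_contra! hge
    rcases hge.eq_or_lt with h0 | hpos
    · exact not_ae_tendsto_sum_atBot_of_integral_eq_zero hmeas hindep hident hL2 h0.symm hlim
    · obtain ⟨ω, hω, hs⟩ := (hlim.and hslln).exists
      have htop := (hs.pos_mul_atTop hpos tendsto_natCast_atTop_atTop).congr' (hcancel ω)
      obtain ⟨n, h1, h2⟩ := ((hω.eventually (eventually_lt_atBot 0)).and
        (htop.eventually (eventually_gt_atTop 0))).exists
      exact lt_asymm h1 h2
  · intro hneg
    filter_upwards [hslln] with ω hs
    exact (hs.neg_mul_atTop hneg tendsto_natCast_atTop_atTop).congr' (hcancel ω)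

/-! ### From the scheme to a random walk -/

theorem map_eq_restrict_of_isUniform {Ω : Type*} [MeasurableSpace Ω] {P : Measure Ω} {X : Ω → ℝ}
    (hX : pdf.IsUniform X (Set.Icc (0 : ℝ) 1) P volume) :
    P.map X = volume.restrict (Set.Icc (0 : ℝ) 1) := by
  rw [hX, ProbabilityTheory.cond]
  simp

/-- Nonvanishing is essential: since `Real.log 0 = 0`, a zero factor would kill the product but be
invisible in the sum. -/
theorem tendsto_prod_zero_iff_tendsto_sum_log {a : ℕ → ℂ} (ha : ∀ j, a j ≠ 0) :
    Tendsto (fun n => ∏ j ∈ Finset.range n, a j) atTop (𝓝 0) ↔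
      Tendsto (fun n => ∑ j ∈ Finset.range n, Real.log ‖a j‖) atTop atBot := by
  rw [tendsto_zero_iff_norm_tendsto_zero, ← Real.tendsto_exp_comp_nhds_zero]
  refine tendsto_congr fun n => ?_
  rw [norm_prod, Real.exp_sum]
  exact Finset.prod_congr rfl fun j _ => (Real.exp_log (norm_pos_iff.2 (ha j))).symm

theorem ae_stabilityFactor_ne_zero (z : ℂ) (μ : Measure ℝ) [NullSingletonClass μ] :
    ∀ᵐ t : ℝ ∂μ, (t : ℂ) * z ^ 2 + z + 1 ≠ 0 := by
  have hsub : {t : ℝ | (t : ℂ) * z ^ 2 + z + 1 = 0}.Subsingleton := by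
    intro s hs t ht
    simp only [Set.mem_ofPred_eq] at hs ht
    have hz : z ≠ 0 := by
      rintro rfl
      simp at hs
    have : ((s : ℂ) - t) * z ^ 2 = 0 := by linear_combination hs - ht
    rcases mul_eq_zero.1 this with h | h
    · exact_mod_cast sub_eq_zero.1 h
    · exact absurd h (pow_ne_zero 2 hz)
  rw [ae_iff]
  simpa using hsub.measure_zero μ

theorem mem_regionAS_iff {Ω : Type*} [MeasurableSpace Ω] {P : Measure Ω} [IsProbabilityMeasure P]
    {τ : ℕ → Ω → ℝ} (hτ_meas : ∀ j, Measurable (τ j)) (hτ_indep : iIndepFun τ P)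
    (hτ_unif : ∀ j, pdf.IsUniform (τ j) (Set.Icc (0 : ℝ) 1) P volume)
    {h : ℝ} (hh : 0 < h) {η : ℂ} (hη : η ≠ 0) {z : ℂ}
    (hL2 : MemLp (fun t : ℝ => Real.log ‖(t : ℂ) * z ^ 2 + z + 1‖) 2
      (volume.restrict (Set.Icc (0 : ℝ) 1))) :
    z ∈ regionAS P τ h η ↔ ∫ ω, Real.log ‖(τ 0 ω : ℂ) * z ^ 2 + z + 1‖ ∂P < 0 := by
  have hh' : (h : ℂ) ≠ 0 := by exact_mod_cast hh.ne'
  have hlog : Measurable fun t : ℝ => Real.log ‖(t : ℂ) * z ^ 2 + z + 1‖ := by fun_prop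
  have hident : ∀ j, IdentDistrib (τ j) (τ 0) P P := fun j =>
    ⟨(hτ_meas j).aemeasurable, (hτ_meas 0).aemeasurable, by
      rw [map_eq_restrict_of_isUniform (hτ_unif j), map_eq_restrict_of_isUniform (hτ_unif 0)]⟩
  have hwalk := ae_tendsto_sum_atBot_iff (P := P)
    (X := fun j ω => Real.log ‖(τ j ω : ℂ) * z ^ 2 + z + 1‖)
    (fun j => hlog.comp (hτ_meas j)) (hτ_indep.comp _ fun _ => hlog)
    (fun j => (hident j).comp hlog)
    ((map_eq_restrict_of_isUniform (hτ_unif 0) ▸ hL2).comp_of_map (hτ_meas 0).aemeasurable)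
  have hne : ∀ᵐ ω ∂P, ∀ j, (τ j ω : ℂ) * z ^ 2 + z + 1 ≠ 0 := by
    refine ae_all_iff.2 fun j => ae_of_ae_map (hτ_meas j).aemeasurable
      (p := fun t : ℝ => (t : ℂ) * z ^ 2 + z + 1 ≠ 0) ?_
    rw [map_eq_restrict_of_isUniform (hτ_unif j)]
    exact ae_stabilityFactor_ne_zero z _
  rw [← hwalk]
  have hstep : z ∈ regionAS P τ h η ↔ ∀ᵐ ω ∂P,
      Tendsto (fun k => η * ∏ j ∈ Finset.range k, ((τ j ω : ℂ) * z ^ 2 + z + 1)) atTop (𝓝 0) := by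
    simp only [regionAS, Set.mem_ofPred_eq, rrkScheme_linear]
    constructor
    · rintro ⟨lam, rfl, hlim⟩
      exact hlim
    · intro hlim
      refine ⟨z / h, by field_simp, ?_⟩
      rwa [mul_div_cancel₀ _ hh']
  rw [hstep]
  refine eventually_congr ?_
  filter_upwards [hne] with ω hω
  rw [← tendsto_prod_zero_iff_tendsto_sum_log hω]
  constructor
  · intro hlim
    simpa [hη] using hlim.const_mul η⁻¹
  · intro hlim
    simpa using hlim.const_mul η

/-! ### Square integrability of the logarithm -/

/-- For `|s| ≤ 1` this squares `|log u| * u ^ (1/6) < 6`; the exponent `-1/3 > -1` keeps the bound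
locally integrable. For `|s| ≥ 1` the term `s ^ 2` suffices. -/
theorem sq_log_le (s : ℝ) : Real.log s ^ 2 ≤ 36 * |s| ^ (-(1 / 3) : ℝ) + s ^ 2 := by
  rw [← Real.log_abs s, ← sq_abs s]
  rcases (abs_nonneg s).eq_or_lt with h0 | hpos
  · rw [← h0]
    rw [Real.log_zero, zero_pow two_ne_zero]
    positivity
  have hr : 0 ≤ |s| ^ (-(1 / 3) : ℝ) := by positivity
  generalize |s| = u at *
  rcases le_total u 1 with h1 | h1
  · have hlt := Real.abs_log_mul_self_rpow_lt u (1 / 6) hpos h1 (by norm_num)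
    have hsq : (Real.log u * u ^ (1 / 6 : ℝ)) ^ 2 ≤ 36 := by
      rw [← sq_abs]
      nlinarith [abs_nonneg (Real.log u * u ^ (1 / 6 : ℝ))]
    have hu : (u ^ (1 / 6 : ℝ)) ^ 2 * u ^ (-(1 / 3) : ℝ) = 1 := by
      rw [← Real.rpow_natCast, ← Real.rpow_mul hpos.le, ← Real.rpow_add hpos]
      norm_num
    calc Real.log u ^ 2 = (Real.log u * u ^ (1 / 6 : ℝ)) ^ 2 * u ^ (-(1 / 3) : ℝ) := by
          rw [mul_pow, mul_assoc, hu, mul_one]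
      _ ≤ 36 * u ^ (-(1 / 3) : ℝ) := mul_le_mul_of_nonneg_right hsq hr
      _ ≤ _ := by nlinarith
  · have h2 := Real.log_le_sub_one_of_pos hpos
    have h3 := Real.log_nonneg h1
    nlinarith

theorem intervalIntegrable_abs_rpow {r : ℝ} (hr : -1 < r) (a b : ℝ) :
    IntervalIntegrable (fun s : ℝ => |s| ^ r) volume a b := by
  have h := (intervalIntegral.intervalIntegrable_cpow' (a := a) (b := b) (r := (r : ℂ))
    (by simpa using hr)).norm
  simpa [Complex.norm_cpow_real] using h

theorem memLp_two_log_sub (c : ℝ) :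
    MemLp (fun t : ℝ => Real.log (t - c)) 2 (volume.restrict (Set.Icc (0 : ℝ) 1)) := by
  rw [memLp_two_iff_integrable_sq (Measurable.aestronglyMeasurable (by fun_prop))]
  have hdom : IntervalIntegrable (fun t : ℝ => 36 * |t - c| ^ (-(1 / 3) : ℝ) + (t - c) ^ 2)
      volume 0 1 := by
    refine IntervalIntegrable.add (.const_mul ?_ _) (Continuous.intervalIntegrable (by fun_prop) _ _)
    simpa using
      (intervalIntegrable_abs_rpow (r := -(1 / 3)) (by norm_num) (0 - c) (1 - c)).comp_sub_right c
  rw [intervalIntegrable_iff_integrableOn_Icc_of_le zero_le_one] at hdom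
  refine hdom.mono' (Measurable.aestronglyMeasurable (by fun_prop)) (ae_of_all _ fun t => ?_)
  rw [Real.norm_of_nonneg (sq_nonneg _)]
  exact sq_log_le _

theorem stabilityFactor_eq {z : ℂ} (hz : z ≠ 0) (t : ℝ) :
    (t : ℂ) * z ^ 2 + z + 1 = z ^ 2 * (t - -(1 / z + 1 / z ^ 2)) := by
  field_simp
  ring

/-- Bounds the complex singularity by a real one; `Real.log` is even, so the sign of `t - w.re` is
immaterial. -/
theorem log_sub_re_le_log_norm {w : ℂ} {t : ℝ} (ht : t ≠ w.re) :
    Real.log (t - w.re) ≤ Real.log ‖(t : ℂ) - w‖ := by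
  rw [← Real.log_abs]
  refine Real.log_le_log (abs_pos.2 (sub_ne_zero.2 ht)) ?_
  simpa using Complex.abs_re_le_norm ((t : ℂ) - w)

theorem log_norm_stabilityFactor {z : ℂ} (hz : z ≠ 0) {t : ℝ}
    (ht : t ≠ (-(1 / z + 1 / z ^ 2)).re) :
    Real.log ‖(t : ℂ) * z ^ 2 + z + 1‖ =
      2 * Real.log ‖z‖ + Real.log ‖(t : ℂ) - -(1 / z + 1 / z ^ 2)‖ := by
  rw [stabilityFactor_eq hz, norm_mul, norm_pow, Real.log_mul, Real.log_pow]
  · norm_num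
  · simpa using hz
  · rw [norm_ne_zero_iff, sub_ne_zero]
    intro h
    exact ht (by rw [← h, Complex.ofReal_re])

theorem abs_log_norm_sub_le (w : ℂ) {t : ℝ} (ht : t ∈ Set.Icc (0 : ℝ) 1) (hne : t ≠ w.re) :
    |Real.log ‖(t : ℂ) - w‖| ≤ 1 + ‖w‖ + |Real.log (t - w.re)| := by
  have hlow := log_sub_re_le_log_norm hne
  have hnorm : ‖(t : ℂ) - w‖ ≤ 1 + ‖w‖ := (norm_sub_le _ _).trans (by
    rw [Complex.norm_real, Real.norm_of_nonneg ht.1]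
    linarith [ht.2])
  have hup := (Real.log_le_self (norm_nonneg ((t : ℂ) - w))).trans hnorm
  refine abs_le.2 ⟨?_, ?_⟩
  · linarith [neg_abs_le (Real.log (t - w.re)), norm_nonneg w]
  · linarith [abs_nonneg (Real.log (t - w.re))]

theorem memLp_log_norm_stabilityFactor (z : ℂ) :
    MemLp (fun t : ℝ => Real.log ‖(t : ℂ) * z ^ 2 + z + 1‖) 2
      (volume.restrict (Set.Icc (0 : ℝ) 1)) := by
  rcases eq_or_ne z 0 with rfl | hz
  · simp
  obtain ⟨w, hw⟩ : ∃ w : ℂ, w = -(1 / z + 1 / z ^ 2) := ⟨_, rfl⟩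
  have hdom : MemLp (fun t : ℝ => (|2 * Real.log ‖z‖| + (1 + ‖w‖)) + ‖Real.log (t - w.re)‖) 2
      (volume.restrict (Set.Icc (0 : ℝ) 1)) :=
    (memLp_const (|2 * Real.log ‖z‖| + (1 + ‖w‖))).add (memLp_two_log_sub w.re).norm
  refine hdom.mono' (Measurable.aestronglyMeasurable (by fun_prop)) ?_
  filter_upwards [ae_restrict_mem measurableSet_Icc, Measure.ae_ne _ w.re] with t ht hne
  rw [log_norm_stabilityFactor hz (hw ▸ hne), Real.norm_eq_abs, ← hw, add_assoc]
  exact (abs_add_le _ _).trans (add_le_add_right (abs_log_norm_sub_le w ht hne) _)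

/-- The mean logarithmic growth `𝔼 log |τ z ^ 2 + z + 1|` of the scheme, for `τ` uniform on `[0, 1]`. -/
noncomputable def meanLogGrowth (z : ℂ) : ℝ :=
  ∫ t in (0 : ℝ)..1, Real.log ‖(t : ℂ) * z ^ 2 + z + 1‖

theorem intervalIntegrable_log_norm_stabilityFactor (z : ℂ) :
    IntervalIntegrable (fun t : ℝ => Real.log ‖(t : ℂ) * z ^ 2 + z + 1‖) volume 0 1 := by
  rw [intervalIntegrable_iff_integrableOn_Icc_of_le zero_le_one]
  exact (memLp_log_norm_stabilityFactor z).integrable (by norm_num)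

theorem integral_log_norm_eq_meanLogGrowth {Ω : Type*} [MeasurableSpace Ω] {P : Measure Ω}
    {X : Ω → ℝ} (hX : Measurable X) (hunif : pdf.IsUniform X (Set.Icc (0 : ℝ) 1) P volume) (z : ℂ) :
    ∫ ω, Real.log ‖(X ω : ℂ) * z ^ 2 + z + 1‖ ∂P = meanLogGrowth z := by
  rw [meanLogGrowth, intervalIntegral.integral_of_le zero_le_one, ← integral_Icc_eq_integral_Ioc,
    ← map_eq_restrict_of_isUniform hunif, integral_map hX.aemeasurable (Measurable.aestronglyMeasurable (by fun_prop))]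

/-! ### Openness and symmetry -/

theorem isOpen_meanLogGrowth_neg : IsOpen {z : ℂ | meanLogGrowth z < 0} := by
  -- Regularized logarithm: jointly continuous for `ε > 0`, above the true one, and converging to it
  -- as `ε → 0+`.
  let φ : ℝ → ℂ → ℝ → ℝ := fun ε z t => Real.log (‖(t : ℂ) * z ^ 2 + z + 1‖ ^ 2 + ε) / 2
  have hle : ∀ (z : ℂ) (t ε : ℝ), 0 ≤ ε → (t : ℂ) * z ^ 2 + z + 1 ≠ 0 →
      Real.log ‖(t : ℂ) * z ^ 2 + z + 1‖ ≤ φ ε z t := by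
    intro z t ε hε hne
    have hpos : 0 < ‖(t : ℂ) * z ^ 2 + z + 1‖ := norm_pos_iff.2 hne
    have := Real.log_le_log (pow_pos hpos 2)
      (le_add_of_nonneg_right hε : _ ≤ ‖(t : ℂ) * z ^ 2 + z + 1‖ ^ 2 + ε)
    rw [Real.log_pow] at this
    simp only [φ]
    push_cast at this
    linarith
  have hcont : ∀ ε, 0 < ε → Continuous fun p : ℂ × ℝ => φ ε p.1 p.2 := by
    intro ε hε
    refine (Continuous.log (by fun_prop) fun p => ?_).div_const 2
    positivity
  have hcontG : ∀ ε, 0 < ε → Continuous fun z => ∫ t in (0 : ℝ)..1, φ ε z t := fun ε hε =>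
    intervalIntegral.continuous_parametric_intervalIntegral_of_continuous' (hcont ε hε) 0 1
  have hleG : ∀ ε, 0 < ε → ∀ z, meanLogGrowth z ≤ ∫ t in (0 : ℝ)..1, φ ε z t := by
    intro ε hε z
    refine intervalIntegral.integral_mono_ae zero_le_one
      (intervalIntegrable_log_norm_stabilityFactor z)
      (((hcont ε hε).comp (Continuous.prodMk_right z)).intervalIntegrable _ _) ?_
    filter_upwards [ae_stabilityFactor_ne_zero z volume] with t ht using hle z t ε hε.le ht
  rw [isOpen_iff_mem_nhds]
  intro z hz
  have hlim : Tendsto (fun ε => ∫ t in (0 : ℝ)..1, φ ε z t) (𝓝[>] 0) (𝓝 (meanLogGrowth z)) := by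
    refine intervalIntegral.tendsto_integral_filter_of_dominated_convergence
      -- For `0 < ε < 1`, `φ ε` lies between the logarithm and `φ 1`.
      (fun t => |Real.log ‖(t : ℂ) * z ^ 2 + z + 1‖| + |φ 1 z t|) ?_ ?_ ?_ ?_
    · filter_upwards [self_mem_nhdsWithin] with ε hε
      exact ((hcont ε hε).comp (Continuous.prodMk_right z)).aestronglyMeasurable
    · filter_upwards [Ioo_mem_nhdsGT one_pos] with ε hε
      filter_upwards [ae_stabilityFactor_ne_zero z volume] with t ht _
      have h1 := hle z t ε hε.1.le ht
      have hpos : 0 < ‖(t : ℂ) * z ^ 2 + z + 1‖ := norm_pos_iff.2 ht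
      have h2 : φ ε z t ≤ φ 1 z t := by
        simp only [φ]
        have := hε.1
        have := hε.2
        gcongr
      rw [Real.norm_eq_abs]
      exact (abs_le_max_abs_abs h1 h2).trans
        (max_le_add_of_nonneg (abs_nonneg _) (abs_nonneg _))
    · exact (intervalIntegrable_log_norm_stabilityFactor z).abs.add
        (((hcont 1 one_pos).comp (Continuous.prodMk_right z)).intervalIntegrable _ _).abs
    · filter_upwards [ae_stabilityFactor_ne_zero z volume] with t ht _
      have hpos : 0 < ‖(t : ℂ) * z ^ 2 + z + 1‖ := norm_pos_iff.2 ht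
      have hc : ContinuousAt (fun ε => φ ε z t) 0 := by
        refine (ContinuousAt.log (by fun_prop) ?_).div_const 2
        positivity
      have h0 : φ 0 z t = Real.log ‖(t : ℂ) * z ^ 2 + z + 1‖ := by
        simp only [φ, add_zero, Real.log_pow]
        push_cast
        ring
      rw [← h0]
      exact hc.tendsto.mono_left nhdsWithin_le_nhds
  obtain ⟨ε, hε, hε0⟩ := ((hlim.eventually (gt_mem_nhds hz)).and self_mem_nhdsWithin).exists
  filter_upwards [(hcontG ε hε0).continuousAt.eventually (gt_mem_nhds hε)] with z' hz'
  exact (hleG ε hε0 z').trans_lt hz'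

theorem meanLogGrowth_conj (z : ℂ) : meanLogGrowth ((starRingEnd ℂ) z) = meanLogGrowth z := by
  refine intervalIntegral.integral_congr fun t _ => ?_
  have : (t : ℂ) * (starRingEnd ℂ) z ^ 2 + (starRingEnd ℂ) z + 1 =
      (starRingEnd ℂ) ((t : ℂ) * z ^ 2 + z + 1) := by simp
  simp only [this, Complex.norm_conj]

/-! ### The closed right half-plane and large arguments -/

/-- For `Re z ≥ 0`, each squared norm is at least its value at `i Im z`; there the product expands
as `1` plus nonnegative terms. -/
theorem one_le_sq_norm_mul_sq_norm_reflect {z : ℂ} (hz : 0 ≤ z.re) {t : ℝ} (h0 : 0 ≤ t)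
    (h1 : t ≤ 1) :
    1 ≤ ‖(t : ℂ) * z ^ 2 + z + 1‖ ^ 2 * ‖((1 - t : ℝ) : ℂ) * z ^ 2 + z + 1‖ ^ 2 := by
  have key : ∀ s : ℝ, 0 ≤ s →
      (1 - s * z.im ^ 2) ^ 2 + z.im ^ 2 ≤ ‖(s : ℂ) * z ^ 2 + z + 1‖ ^ 2 := by
    intro s hs
    have hnorm : ‖(s : ℂ) * z ^ 2 + z + 1‖ ^ 2 = (1 - s * z.im ^ 2) ^ 2 + z.im ^ 2 +
        z.re * (s ^ 2 * z.re * (z.re ^ 2 + 2 * z.im ^ 2) + 2 * s * z.re * (z.re + 1) +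
          2 * s * z.im ^ 2 + z.re + 2) := by
      rw [Complex.sq_norm, Complex.normSq_apply]
      simp [pow_two]
      ring
    rw [hnorm]
    have : 0 ≤ z.re * (s ^ 2 * z.re * (z.re ^ 2 + 2 * z.im ^ 2) + 2 * s * z.re * (z.re + 1) +
          2 * s * z.im ^ 2 + z.re + 2) := by positivity
    linarith
  refine le_trans ?_ (mul_le_mul (key t h0) (key (1 - t) (by linarith)) (by positivity)
    (by positivity))
  have hq : 0 ≤ t * (1 - t) := mul_nonneg h0 (by linarith)
  have hid : ((1 - t * z.im ^ 2) ^ 2 + z.im ^ 2) * ((1 - (1 - t) * z.im ^ 2) ^ 2 + z.im ^ 2) =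
      1 + 2 * (t * (1 - t)) * z.im ^ 4 + (1 - 2 * t) ^ 2 * z.im ^ 6 +
        (t * (1 - t)) ^ 2 * z.im ^ 8 := by ring
  rw [hid]
  have h6 : 0 ≤ z.im ^ 6 := by positivity
  have h8 : 0 ≤ z.im ^ 8 := by positivity
  have h4 : 0 ≤ z.im ^ 4 := by positivity
  have := mul_nonneg hq h4
  have := mul_nonneg (sq_nonneg (1 - 2 * t)) h6
  have := mul_nonneg (sq_nonneg (t * (1 - t))) h8
  linarith

theorem meanLogGrowth_nonneg_of_re_nonneg {z : ℂ} (hz : 0 ≤ z.re) : 0 ≤ meanLogGrowth z := by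
  have hint := intervalIntegrable_log_norm_stabilityFactor z
  have hrefl : ∫ t in (0 : ℝ)..1, Real.log ‖((1 - t : ℝ) : ℂ) * z ^ 2 + z + 1‖ =
      meanLogGrowth z := by
    have := intervalIntegral.integral_comp_sub_left
      (fun t : ℝ => Real.log ‖(t : ℂ) * z ^ 2 + z + 1‖) (a := 0) (b := 1) 1
    simpa [meanLogGrowth] using this
  have hint' : IntervalIntegrable
      (fun t : ℝ => Real.log ‖((1 - t : ℝ) : ℂ) * z ^ 2 + z + 1‖) volume 0 1 := by
    simpa using (hint.comp_sub_left 1).symm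
  have hsum : 0 ≤ ∫ t in (0 : ℝ)..1, (Real.log ‖(t : ℂ) * z ^ 2 + z + 1‖ +
      Real.log ‖((1 - t : ℝ) : ℂ) * z ^ 2 + z + 1‖) := by
    refine intervalIntegral.integral_nonneg zero_le_one fun t ht => ?_
    have h := one_le_sq_norm_mul_sq_norm_reflect hz ht.1 ht.2
    have ha : ‖(t : ℂ) * z ^ 2 + z + 1‖ ≠ 0 := fun h0 => by
      rw [h0] at h
      norm_num at h
    have hb : ‖((1 - t : ℝ) : ℂ) * z ^ 2 + z + 1‖ ≠ 0 := fun h0 => by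
      rw [h0] at h
      norm_num at h
    rw [← Real.log_mul ha hb]
    refine Real.log_nonneg ?_
    rw [← mul_pow] at h
    exact (one_le_sq_iff₀ (by positivity)).1 h
  rw [intervalIntegral.integral_add hint hint', hrefl] at hsum
  change 0 ≤ meanLogGrowth z + meanLogGrowth z at hsum
  linarith

/-- With antiderivative `u log u - u`, the endpoint `1 - c` contributes at least `-c ≥ -1/2`, the
endpoint `-c` at least `-1`, and the linear part `-1`. -/
theorem neg_le_integral_log_sub {c : ℝ} (hc : |c| ≤ 1 / 2) :
    -(5 / 2) ≤ ∫ t in (0 : ℝ)..1, Real.log (t - c) := by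
  rw [intervalIntegral.integral_comp_sub_right Real.log c, integral_log]
  have lower : ∀ u : ℝ, 0 ≤ u → u - 1 ≤ u * Real.log u := by
    intro u hu
    rcases hu.eq_or_lt with rfl | hpos
    · simp
    · have := Real.one_sub_inv_le_log_of_pos hpos
      calc u - 1 = u * (1 - u⁻¹) := by field_simp
        _ ≤ _ := mul_le_mul_of_nonneg_left this hu
  obtain ⟨hc1, hc2⟩ := abs_le.1 hc
  have h1 := lower (1 - c) (by linarith)
  have h2 : -1 ≤ -((0 - c) * Real.log (0 - c)) := by
    rw [zero_sub, Real.log_neg_eq_log]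
    rcases le_total 0 c with h | h
    · linarith [lower c h]
    · have : Real.log c ≤ 0 := by
        rw [← Real.log_abs]
        exact Real.log_nonpos (abs_nonneg _) (by linarith)
      nlinarith [mul_nonneg_of_nonpos_of_nonpos h this]
  linarith

/-- Extracting `z ^ 2` gains `2 log |z| ≥ 4`, more than the loss `5/2`; `exp 2 ≥ 4` forces the root
in `t` to have modulus at most `1/2`. -/
theorem meanLogGrowth_nonneg_of_large {z : ℂ} (hz : Real.exp 2 ≤ ‖z‖) : 0 ≤ meanLogGrowth z := by
  have h4 : 4 ≤ ‖z‖ := by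
    have : (2 : ℝ) ≤ Real.exp 1 := by linarith [Real.add_one_le_exp 1]
    have h2 : Real.exp 2 = Real.exp 1 * Real.exp 1 := by rw [← Real.exp_add]; norm_num
    nlinarith
  have hz0 : z ≠ 0 := norm_pos_iff.1 (by linarith)
  have hlog : 2 ≤ Real.log ‖z‖ := (Real.le_log_iff_exp_le (by linarith)).2 hz
  set w : ℂ := -(1 / z + 1 / z ^ 2) with hw
  have hwle : |w.re| ≤ 1 / 2 := by
    refine (Complex.abs_re_le_norm w).trans ?_
    rw [hw, norm_neg]
    refine (norm_add_le _ _).trans ?_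
    rw [norm_div, norm_div, norm_pow, norm_one]
    have h1 : 1 / ‖z‖ ≤ 1 / 4 := one_div_le_one_div_of_le (by norm_num) h4
    have h2 : 1 / ‖z‖ ^ 2 ≤ 1 / 4 := one_div_le_one_div_of_le (by norm_num) (by nlinarith)
    linarith
  have hint : IntervalIntegrable (fun t : ℝ => Real.log (t - w.re)) volume 0 1 := by
    rw [intervalIntegrable_iff_integrableOn_Icc_of_le zero_le_one]
    exact (memLp_two_log_sub w.re).integrable (by norm_num)
  have hmono : ∫ t in (0 : ℝ)..1, (2 * Real.log ‖z‖ + Real.log (t - w.re)) ≤ meanLogGrowth z := by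
    refine intervalIntegral.integral_mono_ae zero_le_one (intervalIntegrable_const.add hint)
      (intervalIntegrable_log_norm_stabilityFactor z) ?_
    filter_upwards [Measure.ae_ne volume w.re] with t ht
    rw [log_norm_stabilityFactor hz0 ht]
    exact add_le_add_right (log_sub_re_le_log_norm ht) _
  rw [intervalIntegral.integral_add intervalIntegrable_const hint,
    intervalIntegral.integral_const] at hmono
  have := neg_le_integral_log_sub hwle
  simp only [sub_zero, one_smul] at hmono
  linarith

/-! ### The real axis -/

theorem meanLogGrowth_ofReal (x : ℝ) :
    meanLogGrowth (x : ℂ) = ∫ t in (0 : ℝ)..1, Real.log (x ^ 2 * t + (x + 1)) := by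
  refine intervalIntegral.integral_congr fun t _ => ?_
  have : (t : ℂ) * (x : ℂ) ^ 2 + x + 1 = ((x ^ 2 * t + (x + 1) : ℝ) : ℂ) := by
    push_cast
    ring
  simp only [this, Complex.norm_real, Real.norm_eq_abs, Real.log_abs]

/-- The factor `x ^ 2` comes from the substitution `u = x ^ 2 t + x + 1` and keeps the formula valid
at `x = 0`. -/
theorem sq_mul_meanLogGrowth_ofReal (x : ℝ) :
    x ^ 2 * meanLogGrowth (x : ℂ) = (x ^ 2 + x + 1) * Real.log (x ^ 2 + x + 1) -
      (x + 1) * Real.log (x + 1) - x ^ 2 := by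
  rw [meanLogGrowth_ofReal, intervalIntegral.mul_integral_comp_mul_add, integral_log]
  ring_nf

/-- On `(-1, 0)`, `log u ≤ u - 1` gives the bound `x ^ 2 / 2 + x`. On `[-2, -1]`, put `b = x ^ 2 + x
+ 1` in the closed form: `b log b ≤ b ^ 2 / e < x ^ 2`, and `(x + 1) log (x + 1) ≥ 0`. -/
theorem meanLogGrowth_ofReal_neg {x : ℝ} (h1 : -2 ≤ x) (h2 : x < 0) :
    meanLogGrowth (x : ℂ) < 0 := by
  rcases lt_or_ge (-1) x with hx | hx
  · have hpos : ∀ t ∈ Set.Icc (0 : ℝ) 1, 0 < x ^ 2 * t + (x + 1) := fun t ht =>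
      add_pos_of_nonneg_of_pos (mul_nonneg (sq_nonneg _) ht.1) (by linarith)
    have hle : meanLogGrowth (x : ℂ) ≤ ∫ t in (0 : ℝ)..1, (x ^ 2 * t + x) := by
      rw [meanLogGrowth_ofReal]
      refine intervalIntegral.integral_mono_on zero_le_one
        (ContinuousOn.intervalIntegrable_of_Icc zero_le_one ?_)
        (Continuous.intervalIntegrable (by fun_prop) _ _) fun t ht => ?_
      · exact ContinuousOn.log (by fun_prop) fun t ht => (hpos t ht).ne'
      · linarith [Real.log_le_sub_one_of_pos (hpos t ht)]
    have hval : ∫ t in (0 : ℝ)..1, (x ^ 2 * t + x) = x ^ 2 / 2 + x := by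
      rw [intervalIntegral.integral_add (Continuous.intervalIntegrable (by fun_prop) _ _)
        intervalIntegrable_const, intervalIntegral.integral_const_mul, integral_id]
      simp
      ring
    nlinarith
  · have hform := sq_mul_meanLogGrowth_ofReal x
    have hx2 : 0 < x ^ 2 := by nlinarith
    have hb : 0 < x ^ 2 + x + 1 := by nlinarith
    have ha : 0 ≤ (x + 1) * Real.log (x + 1) := by
      refine mul_nonneg_of_nonpos_of_nonpos (by linarith) ?_
      rw [← Real.log_neg_eq_log]
      exact Real.log_nonpos (by linarith) (by linarith)
    have he : (27 / 10 : ℝ) < Real.exp 1 := by linarith [Real.exp_one_gt_d9]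
    have hlogb : Real.log (x ^ 2 + x + 1) ≤ (x ^ 2 + x + 1) / (27 / 10) := by
      have h := Real.log_le_sub_one_of_pos (div_pos hb (Real.exp_pos 1))
      rw [Real.log_div hb.ne' (Real.exp_pos 1).ne', Real.log_exp] at h
      have : (x ^ 2 + x + 1) / Real.exp 1 ≤ (x ^ 2 + x + 1) / (27 / 10) := by gcongr
      linarith
    have hblog := mul_le_mul_of_nonneg_left hlogb hb.le
    have hpoly : (x ^ 2 + x + 1) * ((x ^ 2 + x + 1) / (27 / 10)) < x ^ 2 := by
      -- Squaring suffices, as `(8/5) ^ 2 = 2.56 < 2.7`.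
      have : (x ^ 2 + x + 1) < -(8 / 5) * x := by nlinarith
      nlinarith
    by_contra! hge
    nlinarith [mul_nonneg hx2.le hge]

/-- Midpoint convexity of `u log u` at `x ^ 2 + x + 1` and `-(x + 1)`, whose mean is `x ^ 2 / 2`,
bounds the closed form below by `x ^ 2 (log (x ^ 2 / 2) - 1)`; this is where `2e` arises. -/
theorem meanLogGrowth_ofReal_nonneg {x : ℝ} (hx : x ≤ -√(2 * Real.exp 1)) :
    0 ≤ meanLogGrowth (x : ℂ) := by
  have he : (2 : ℝ) ≤ Real.exp 1 := by linarith [Real.add_one_le_exp 1]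
  have hsq : 2 * Real.exp 1 ≤ x ^ 2 := by
    have := Real.sq_sqrt (show 0 ≤ 2 * Real.exp 1 by positivity)
    nlinarith [Real.sqrt_nonneg (2 * Real.exp 1)]
  have hx1 : x ≤ -1 := by nlinarith [Real.sqrt_nonneg (2 * Real.exp 1)]
  have hconv := Real.convexOn_mul_log.2 (x := x ^ 2 + x + 1) (y := -(x + 1))
    (Set.mem_Ici.2 (by nlinarith)) (Set.mem_Ici.2 (by linarith))
    (show (0 : ℝ) ≤ 1 / 2 by norm_num) (show (0 : ℝ) ≤ 1 / 2 by norm_num) (by norm_num)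
  have hmid : (1 / 2 : ℝ) • (x ^ 2 + x + 1) + (1 / 2 : ℝ) • -(x + 1) = x ^ 2 / 2 := by
    simp only [smul_eq_mul]
    ring
  rw [hmid] at hconv
  simp only [smul_eq_mul, Real.log_neg_eq_log] at hconv
  have hlog : 1 ≤ Real.log (x ^ 2 / 2) :=
    (Real.le_log_iff_exp_le (by linarith)).2 (by linarith)
  have hform := sq_mul_meanLogGrowth_ofReal x
  have : x ^ 2 / 2 ≤ x ^ 2 / 2 * Real.log (x ^ 2 / 2) := le_mul_of_one_le_right (by positivity) hlog
  refine nonneg_of_mul_nonneg_right (a := x ^ 2) ?_ (by linarith)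
  linarith

theorem stabInterval_regionMid_subset :
    stabInterval regionMid ⊆ Complex.ofReal '' Set.Ico (-2 : ℝ) 0 := by
  rintro z ⟨hz, him⟩
  have hzx : z = (z.re : ℂ) := Complex.ext rfl (by simpa using him)
  refine ⟨z.re, ?_, hzx.symm⟩
  rw [hzx] at hz
  generalize z.re = x at *
  have hcast : (1 / 2 : ℂ) * (x : ℂ) ^ 2 + x + 1 = ((x ^ 2 / 2 + x + 1 : ℝ) : ℂ) := by
    push_cast
    ring
  have hlt : (x ^ 2 / 2 + x + 1) ^ 2 < 1 := by
    change ‖(1 / 2 : ℂ) * (x : ℂ) ^ 2 + x + 1‖ ^ 2 < 1 at hz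
    rwa [hcast, Complex.norm_real, Real.norm_eq_abs, sq_abs] at hz
  have hneg : x ^ 2 / 2 + x < 0 := by nlinarith
  constructor <;> nlinarith

theorem theorem5p3 {Ω : Type*} [MeasurableSpace Ω] (P : Measure Ω) [IsProbabilityMeasure P]
    (τ : ℕ → Ω → ℝ) (hτ_meas : ∀ j, Measurable (τ j)) (hτ_indep : iIndepFun τ P)
    (hτ_unif : ∀ j, pdf.IsUniform (τ j) (Set.Icc (0 : ℝ) 1) P volume)
    (h : ℝ) (hh : 0 < h) (η : ℂ) (hη : η ≠ 0) :
    -- the description of the region by the sign of an expectation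
    (∀ z : ℂ, Integrable (fun ω => Real.log ‖(τ 0 ω : ℂ) * z ^ 2 + z + 1‖) P) ∧
    regionAS P τ h η = {z : ℂ | ∫ ω, Real.log ‖(τ 0 ω : ℂ) * z ^ 2 + z + 1‖ ∂P < 0} ∧
    -- (i)
    IsOpen (regionAS P τ h η) ∧
    (∀ z : ℂ, (starRingEnd ℂ) z ∈ regionAS P τ h η ↔ z ∈ regionAS P τ h η) ∧
    -- (ii)
    stabInterval regionMid ⊆ Complex.ofReal '' Set.Ico (-2 : ℝ) 0 ∧
    Complex.ofReal '' Set.Ico (-2 : ℝ) 0 ⊆ stabInterval (regionAS P τ h η) ∧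
    stabInterval (regionAS P τ h η) ⊆
      Complex.ofReal '' Set.Ioo (-Real.sqrt (2 * Real.exp 1)) 0 ∧
    -- (iii)
    (∃ r₀ : ℝ, 0 < r₀ ∧ regionAS P τ h η ⊆ {z : ℂ | z.re < 0} ∩ {z : ℂ | ‖z‖ < r₀}) := by
  have hregion : regionAS P τ h η =
      {z : ℂ | ∫ ω, Real.log ‖(τ 0 ω : ℂ) * z ^ 2 + z + 1‖ ∂P < 0} :=
    Set.ext fun z => mem_regionAS_iff hτ_meas hτ_indep hτ_unif hh hη
      (memLp_log_norm_stabilityFactor z)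
  have hgrowth : regionAS P τ h η = {z : ℂ | meanLogGrowth z < 0} := by
    simp_rw [hregion, integral_log_norm_eq_meanLogGrowth (hτ_meas 0) (hτ_unif 0)]
  refine ⟨fun z => ?_, hregion, ?_, fun z => ?_, stabInterval_regionMid_subset, ?_, ?_, ?_⟩
  · have hmem := (memLp_log_norm_stabilityFactor z).integrable (by norm_num)
    rw [← map_eq_restrict_of_isUniform (hτ_unif 0)] at hmem
    exact hmem.comp_measurable (hτ_meas 0)
  · rw [hgrowth]
    exact isOpen_meanLogGrowth_neg
  · rw [hgrowth]
    change meanLogGrowth _ < 0 ↔ meanLogGrowth _ < 0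
    rw [meanLogGrowth_conj]
  · rw [hgrowth]
    rintro _ ⟨x, hx, rfl⟩
    exact ⟨meanLogGrowth_ofReal_neg hx.1 hx.2, Complex.ofReal_im x⟩
  · rw [hgrowth]
    rintro z ⟨hz, him⟩
    have hzx : z = (z.re : ℂ) := Complex.ext rfl (by simpa using him)
    change meanLogGrowth z < 0 at hz
    refine ⟨z.re, ⟨?_, ?_⟩, hzx.symm⟩
    · by_contra! hle
      exact (hzx ▸ hz).not_ge (meanLogGrowth_ofReal_nonneg hle)
    · by_contra! hge
      exact hz.not_ge (meanLogGrowth_nonneg_of_re_nonneg hge)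
  · refine ⟨Real.exp 2, Real.exp_pos 2, ?_⟩
    rw [hgrowth]
    intro z hz
    change meanLogGrowth z < 0 at hz
    constructor
    · by_contra hge
      exact hz.not_ge (meanLogGrowth_nonneg_of_re_nonneg (not_lt.1 hge))
    · by_contra hge
      exact hz.not_ge (meanLogGrowth_nonneg_of_large (not_lt.1 hge))
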